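/- For a positive integer $n$ let $I_n(x)=\sum_{k\ge 0}\frac{(x/2)^{2k+n}}{k!\,(n+k)!}$ and $K_n(x)=\int_0^\infty e^{-x\cosh t}\cosh(nt)\,dt$ $(x>0)$ be the modified Bessel functions of the first and second kind of order $n$, and let a prime denote the derivative with respect to the argument. Fix $h>0$ and $a_1>a_2>0$. For $a,b>0$ and integers $n\ge 1$ put $$\Upsilon(a,b)=\frac{(h^2+a^2)(a^2-b^2)}{2h^2a^2},\qquad \Gamma_n(a,b)=-\frac{ab}{h^2}\,I_n'\!\left(\frac{nb}{h}\right)K_n'\!\left(\frac{na}{h}\right),$$ and for $\Omega\in\mathbb R$ let $$M_n(\Omega,a_1,a_2)=\begin{pmatrix}\Omega+\Gamma_n(a_1,a_1)-\Upsilon(a_1,a_2)&\Gamma_n(a_1,a_2)\\-\Gamma_n(a_1,a_2)&\Omega-\Gamma_n(a_2,a_2)\end{pmatrix}.$$ Then there is a constant $M_h(a_1,a_2)>0$ such that the following holds. (i) For every integer $n>M_h(a_1,a_2)$ the number $\Delta_n=\big(\Upsilon(a_1,a_2)-\Gamma_n(a_1,a_1)-\Gamma_n(a_2,a_2)\big)^2-4\,\Gamma_n(a_1,a_2)^2$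 is positive, and the two distinct real numbers $$\Omega_n^{\pm}=\frac{\Upsilon(a_1,a_2)-\Gamma_n(a_1,a_1)+\Gamma_n(a_2,a_2)}{2}\pm\frac{\sqrt{\Delta_n}}{2}$$ are exactly the values of $\Omega\in\mathbb R$ for which the matrix $M_n(\Omega,a_1,a_2)$ is singular (i.e. non-invertible). (ii) On the integers $n>M_h(a_1,a_2)$ the sequence $\Omega_n^+$ is strictly increasing and the sequence $\Omega_n^-$ is strictly decreasing in $n$. (iii) $\displaystyle\lim_{n\to\infty}\Omega_n^+=\Upsilon(a_1,a_2)>0$ and $\displaystyle\lim_{n\to\infty}\Omega_n^-=0$. -/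

import Mathlib

open Filter Topology
open scoped Nat

noncomputable section

namespace HelicalWave

/-- The modified Bessel function of the first kind of integer order `n`,
`I_n(x) = ∑_{k ≥ 0} (x / 2)^(2 k + n) / (k! (n + k)!)`. -/
def besselI (n : ℕ) (x : ℝ) : ℝ :=
  ∑' k : ℕ, (x / 2) ^ (2 * k + n) / ((k ! : ℝ) * ((n + k)! : ℝ))

/-- The modified Bessel function of the second kind of integer order `n`, for `x > 0`,
`K_n(x) = ∫_0^∞ exp (-x cosh t) cosh (n t) dt`. -/
def besselK (n : ℕ) (x : ℝ) : ℝ :=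
  ∫ t in Set.Ioi (0 : ℝ), Real.exp (-x * Real.cosh t) * Real.cosh (n * t)

/-- `Υ(a, b) = (h² + a²) (a² - b²) / (2 h² a²)`. -/
def Upsilon (h a b : ℝ) : ℝ :=
  (h ^ 2 + a ^ 2) * (a ^ 2 - b ^ 2) / (2 * h ^ 2 * a ^ 2)

/-- `Γ_n(a, b) = - (a b / h²) I_n'(n b / h) K_n'(n a / h)`, the primes being derivatives
with respect to the argument. -/
def Gam (h : ℝ) (n : ℕ) (a b : ℝ) : ℝ :=
  -(a * b / h ^ 2) * deriv (besselI n) (n * b / h) * deriv (besselK n) (n * a / h)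

/-- The matrix `M_n(Ω, a₁, a₂)`. -/
def linMatrix (h : ℝ) (n : ℕ) (Ω a₁ a₂ : ℝ) : Matrix (Fin 2) (Fin 2) ℝ :=
  !![Ω + Gam h n a₁ a₁ - Upsilon h a₁ a₂, Gam h n a₁ a₂;
     -Gam h n a₁ a₂, Ω - Gam h n a₂ a₂]

/-- The discriminant `(Υ(a₁, a₂) - Γ_n(a₁, a₁) - Γ_n(a₂, a₂))² - 4 Γ_n(a₁, a₂)²`. -/
def discr (h : ℝ) (n : ℕ) (a₁ a₂ : ℝ) : ℝ :=
  (Upsilon h a₁ a₂ - Gam h n a₁ a₁ - Gam h n a₂ a₂) ^ 2 - 4 * Gam h n a₁ a₂ ^ 2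

/-- The angular velocity `Ω_n^+`. -/
def OmegaPlus (h : ℝ) (n : ℕ) (a₁ a₂ : ℝ) : ℝ :=
  (Upsilon h a₁ a₂ - Gam h n a₁ a₁ + Gam h n a₂ a₂) / 2 + √(discr h n a₁ a₂) / 2

/-- The angular velocity `Ω_n^-`. -/
def OmegaMinus (h : ℝ) (n : ℕ) (a₁ a₂ : ℝ) : ℝ :=
  (Upsilon h a₁ a₂ - Gam h n a₁ a₁ + Gam h n a₂ a₂) / 2 - √(discr h n a₁ a₂) / 2

end HelicalWave

end

noncomputable section

namespace HelicalWave

open MeasureTheory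

/-! ### The modified Bessel function of the first kind -/

/-! The determinant factors as `(Ω - Ω⁺)(Ω - Ω⁻)`. With `δ_n = T - √(T² - 4 Γ_n(a₁, a₂)²)` and `T =
Υ - Γ_n(a₁, a₁) - Γ_n(a₂, a₂)`, the roots are `Ω⁺ = Υ - (Γ_n(a₁, a₁) + δ_n / 2)` and `Ω⁻ = Γ_n(a₂,
a₂) + δ_n / 2`. Everything follows once both brackets have the form `A / n + O(1 / n³)` with `A >
0`: such a sequence tends to `0`, and its main term drops by `A / (n (n + 1))` at each step, which
eventually beats the error. An error `O(1 / n²)` would not suffice.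

The coupling `Γ_n(a₁, a₂)` is exponentially small (`abs_Gam_le`), so `δ_n` goes into the error. For
the diagonal, put `x = n a / h`, `p = x I_n' / I_n`, `q = -x K_n' / K_n`. The Wronskian identity
`I_n K_n (p + q) = W` gives `Γ_n(a, a) = (W / n²) p q / (p + q)`. Both `p` and `q` solve Riccati
equations, `x p' = x² + n² - p²` and `x q' = q² - (x² + n²)`, and are compared with `s ∓ x² / (2
s²)`, where `s = √(x² + n²)`. Energy estimates, from `0` for `p` and from `∞` for `q`, bound the
errors by `1 / (4 n)` uniformly in `x` (`sq_le_of_stable`, `sq_le_of_unstable`). The opposite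
corrections cancel to first order in `p q / (p + q)`, leaving `s / 2 + O(1 / n)` with `s`
proportional to `n`. -/

/-- The entire function `F_n(y) = ∑ y^k / (k! (n + k)!)`, so that `I_n(x) = (x/2)^n F_n((x/2)^2)`. -/
def besselSeries (n : ℕ) (y : ℝ) : ℝ :=
  ∑' k : ℕ, y ^ k / ((k ! : ℝ) * ((n + k)! : ℝ))

theorem besselSeries_term_le (n k : ℕ) {y : ℝ} (hy : 0 ≤ y) :
    y ^ k / ((k ! : ℝ) * ((n + k)! : ℝ)) ≤ y ^ k / (k ! : ℝ) := by
  have h1 : (1 : ℝ) ≤ ((n + k)! : ℝ) := by exact_mod_cast (n + k).factorial_pos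
  have h2 : (0 : ℝ) < (k ! : ℝ) := by exact_mod_cast k.factorial_pos
  gcongr
  exact le_mul_of_one_le_right h2.le h1

theorem besselSeries_summable (n : ℕ) (y : ℝ) :
    Summable fun k : ℕ => y ^ k / ((k ! : ℝ) * ((n + k)! : ℝ)) := by
  refine Summable.of_norm_bounded (Real.summable_pow_div_factorial |y|) fun k => ?_
  refine le_trans (le_of_eq ?_) (besselSeries_term_le n k (abs_nonneg y))
  rw [Real.norm_eq_abs, abs_div, abs_pow, abs_of_nonneg (by positivity :
    (0 : ℝ) ≤ (k ! : ℝ) * ((n + k)! : ℝ))]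

theorem besselSeries_hasDerivAt (n : ℕ) (y : ℝ) :
    HasDerivAt (besselSeries n) (besselSeries (n + 1) y) y := by
  -- Termwise differentiation on a ball containing both `0` and `y`. Cancelling `k` against `k !`
  -- shifts the index, and `(n + k)!` becomes the factorial of order `n + 1`.
  set R : ℝ := |y| + 1
  have key := hasDerivAt_tsum_of_isPreconnected
    (g := fun (k : ℕ) (y : ℝ) => y ^ k / ((k ! : ℝ) * ((n + k)! : ℝ)))
    (g' := fun (k : ℕ) (y : ℝ) => (k * y ^ (k - 1)) / ((k ! : ℝ) * ((n + k)! : ℝ)))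
    (u := fun k : ℕ => (k * R ^ (k - 1)) / (k ! : ℝ)) (t := Metric.ball 0 R) (y₀ := 0) (y := y)
    ?_ Metric.isOpen_ball (convex_ball _ _).isPreconnected
    (fun k z _ => (hasDerivAt_pow k z).div_const _) ?_ ?_ (besselSeries_summable n 0) ?_
  · refine HasDerivAt.congr_deriv (f := besselSeries n) key ?_
    rw [Summable.tsum_eq_zero_add, besselSeries]
    · simp only [Nat.cast_zero, zero_mul, zero_div, zero_add]
      refine tsum_congr fun k => ?_
      rw [Nat.add_sub_cancel, Nat.factorial_succ, show n + (k + 1) = n + 1 + k by ring]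
      push_cast
      field_simp
    · rw [← summable_nat_add_iff 1]
      refine (besselSeries_summable (n + 1) y).congr fun k => ?_
      rw [Nat.add_sub_cancel, Nat.factorial_succ, show n + (k + 1) = n + 1 + k by ring]
      push_cast
      field_simp
  · rw [← summable_nat_add_iff 1]
    refine (Real.summable_pow_div_factorial R).congr fun k => ?_
    rw [Nat.add_sub_cancel, Nat.factorial_succ]
    push_cast
    field_simp
  · intro k z hz
    have hz' : |z| ≤ R := by simpa using (mem_ball_zero_iff.mp hz).le
    have h1 : (1 : ℝ) ≤ ((n + k)! : ℝ) := by exact_mod_cast (n + k).factorial_pos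
    have h2 : (0 : ℝ) < (k ! : ℝ) := by exact_mod_cast k.factorial_pos
    rw [Real.norm_eq_abs, abs_div, abs_mul, abs_pow, Nat.abs_cast, abs_of_nonneg (by positivity :
      (0 : ℝ) ≤ (k ! : ℝ) * ((n + k)! : ℝ))]
    gcongr
    exact le_mul_of_one_le_right h2.le h1
  · exact Metric.mem_ball_self (by positivity)
  · simp [R]

theorem besselSeries_pos (n : ℕ) {y : ℝ} (hy : 0 ≤ y) : 0 < besselSeries n y :=
  (besselSeries_summable n y).tsum_pos (fun k => by positivity) 0 (by positivity)

theorem besselSeries_mono (n : ℕ) {y z : ℝ} (hy : 0 ≤ y) (hyz : y ≤ z) :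
    besselSeries n y ≤ besselSeries n z :=
  (besselSeries_summable n y).tsum_le_tsum (fun k => by gcongr) (besselSeries_summable n z)

theorem besselSeries_succ_le (n : ℕ) {y : ℝ} (hy : 0 ≤ y) :
    besselSeries (n + 1) y ≤ besselSeries n y :=
  (besselSeries_summable (n + 1) y).tsum_le_tsum (fun k => by gcongr; omega)
    (besselSeries_summable n y)

/-- Write `1 / (n + k)! = (n + 1 + k) / (n + 1 + k)!` and split the numerator into `n + 1` and `k`.
-/
theorem besselSeries_rec (n : ℕ) (y : ℝ) :
    besselSeries n y = (n + 1) * besselSeries (n + 1) y + y * besselSeries (n + 2) y := by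
  have hsum : Summable fun k : ℕ => (k : ℝ) * (y ^ k / ((k ! : ℝ) * ((n + 1 + k)! : ℝ))) := by
    rw [← summable_nat_add_iff 1]
    refine ((besselSeries_summable (n + 2) y).mul_left y).congr fun k => ?_
    rw [Nat.factorial_succ k, show n + 1 + (k + 1) = n + 2 + k by ring]
    push_cast
    field_simp
    ring
  have hs : y * besselSeries (n + 2) y =
      ∑' k : ℕ, k * (y ^ k / ((k ! : ℝ) * ((n + 1 + k)! : ℝ))) := by
    rw [besselSeries, ← tsum_mul_left, Summable.tsum_eq_zero_add (f := fun k : ℕ =>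
      k * (y ^ k / ((k ! : ℝ) * ((n + 1 + k)! : ℝ))))]
    · simp only [Nat.cast_zero, zero_mul, zero_add]
      refine tsum_congr fun k => ?_
      rw [Nat.factorial_succ k, show n + 1 + (k + 1) = n + 2 + k by ring]
      push_cast
      field_simp
      ring
    · exact hsum
  rw [hs, besselSeries, besselSeries, ← tsum_mul_left,
    ← ((besselSeries_summable (n + 1) y).mul_left ((n : ℝ) + 1)).tsum_add hsum]
  refine tsum_congr fun k => ?_
  rw [show n + 1 + k = n + k + 1 by ring, Nat.factorial_succ (n + k)]
  push_cast
  field_simp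
  ring

theorem besselI_eq (n : ℕ) (x : ℝ) :
    besselI n x = (x / 2) ^ n * besselSeries n ((x / 2) ^ 2) := by
  rw [besselI, besselSeries, ← tsum_mul_left]
  refine tsum_congr fun k => ?_
  rw [pow_add, pow_mul]
  ring

theorem besselI_pos (n : ℕ) {x : ℝ} (hx : 0 < x) : 0 < besselI n x := by
  rw [besselI_eq]
  exact mul_pos (by positivity) (besselSeries_pos n (by positivity))

theorem besselI_succ_le (n : ℕ) {x : ℝ} (hx : 0 < x) :
    besselI (n + 1) x ≤ x / 2 * besselI n x := by
  rw [besselI_eq, besselI_eq, pow_succ, mul_comm _ (x / 2), mul_assoc]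
  gcongr
  exact besselSeries_succ_le n (by positivity)

/-- Every term of the series carries at least the power `x ^ n`. This is the source of the
exponential decay of the coupling. -/
theorem besselI_mul_le (n : ℕ) {c x : ℝ} (hc : 0 ≤ c) (hc1 : c ≤ 1) (hx : 0 < x) :
    besselI n (c * x) ≤ c ^ n * besselI n x := by
  rw [besselI_eq, besselI_eq, mul_div_assoc, mul_pow, mul_assoc]
  gcongr
  refine besselSeries_mono n (by positivity) ?_
  gcongr
  exact mul_le_of_le_one_left (by positivity) hc1

theorem besselI_hasDerivAt_aux (n : ℕ) (x : ℝ) :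
    HasDerivAt (besselI n) (n * (x / 2) ^ (n - 1) * (1 / 2) * besselSeries n ((x / 2) ^ 2) +
      (x / 2) ^ n * (besselSeries (n + 1) ((x / 2) ^ 2) * (2 * (x / 2) * (1 / 2)))) x := by
  have h1 : HasDerivAt (fun x : ℝ => x / 2) (1 / 2) x := (hasDerivAt_id x).div_const 2
  have h2 : HasDerivAt (fun x : ℝ => (x / 2) ^ 2) (2 * (x / 2) * (1 / 2)) x := by
    simpa [Pi.pow_def] using h1.pow 2
  have h3 := (h1.pow n).mul ((besselSeries_hasDerivAt n _).comp x h2)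
  rw [show besselI n = fun x => (x / 2) ^ n * besselSeries n ((x / 2) ^ 2) from
    funext (besselI_eq n)]
  exact h3

theorem besselI_hasDerivAt (n : ℕ) {x : ℝ} (hx : 0 < x) :
    HasDerivAt (besselI n) (n / x * besselI n x + besselI (n + 1) x) x := by
  convert besselI_hasDerivAt_aux n x using 1
  rw [besselI_eq, besselI_eq]
  rcases n with _ | n
  · simp; ring
  · rw [Nat.add_sub_cancel]
    push_cast
    field_simp
    ring

theorem besselI_succ_hasDerivAt (n : ℕ) {x : ℝ} (hx : 0 < x) :
    HasDerivAt (besselI (n + 1)) (besselI n x - (n + 1) / x * besselI (n + 1) x) x := by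
  convert besselI_hasDerivAt_aux (n + 1) x using 1
  rw [besselI_eq, besselI_eq, besselSeries_rec n, Nat.add_sub_cancel]
  push_cast
  field_simp
  ring

theorem besselI_rec (n : ℕ) {x : ℝ} (hx : 0 < x) :
    besselI (n + 2) x = besselI n x - 2 * (n + 1) / x * besselI (n + 1) x := by
  have := (besselI_hasDerivAt (n + 1) hx).unique (besselI_succ_hasDerivAt n hx)
  push_cast at this
  linear_combination this

/-! ### The modified Bessel function of the second kind -/

/-- Since `cosh t = 1 + 2 sinh² (t / 2) ≥ t² / 2`, completing the square in `(m + 1) t - x t² / 2`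
gives the constant. All integrability and boundary terms for `K_n` rest on this domination. -/
theorem exp_neg_mul_cosh_mul_exp_le {x : ℝ} (hx : 0 < x) (m t : ℝ) :
    Real.exp (-x * Real.cosh t) * Real.exp (m * t) ≤
      Real.exp ((m + 1) ^ 2 / (2 * x)) * Real.exp (-t) := by
  rw [← Real.exp_add, ← Real.exp_add, Real.exp_le_exp]
  have h1 : t ^ 2 / 2 ≤ Real.cosh t := by
    have h := Real.cosh_two_mul (t / 2)
    rw [mul_div_cancel₀ t two_ne_zero, Real.cosh_sq] at h
    have h' : |t / 2| ≤ |Real.sinh (t / 2)| := by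
      rw [Real.abs_sinh]
      exact Real.self_le_sinh_iff.mpr (abs_nonneg _)
    have := sq_le_sq.mpr h'
    linarith
  have h2 : x * (t ^ 2 / 2) ≤ x * Real.cosh t := by gcongr
  have h3 : (m + 1) ^ 2 / (2 * x) - (m + 1) * t + x * (t ^ 2 / 2) =
      ((m + 1) - x * t) ^ 2 / (2 * x) := by
    field_simp
    ring
  have h4 : 0 ≤ ((m + 1) - x * t) ^ 2 / (2 * x) := by positivity
  linarith

theorem cosh_le_exp {t : ℝ} (ht : 0 ≤ t) : Real.cosh t ≤ Real.exp t := by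
  rw [Real.cosh_eq]
  have : Real.exp (-t) ≤ Real.exp t := Real.exp_le_exp.mpr (by linarith)
  linarith

theorem abs_sinh_le_exp {t : ℝ} (ht : 0 ≤ t) : |Real.sinh t| ≤ Real.exp t := by
  rw [abs_of_nonneg (Real.sinh_nonneg_iff.mpr ht)]
  exact (Real.sinh_lt_cosh t).le.trans (cosh_le_exp ht)

theorem integrableOn_exp_neg_mul_cosh_mul {x : ℝ} (hx : 0 < x) (m : ℝ) {g : ℝ → ℝ}
    (hg : Continuous g) (hgm : ∀ t, 0 < t → |g t| ≤ Real.exp (m * t)) :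
    IntegrableOn (fun t => Real.exp (-x * Real.cosh t) * g t) (Set.Ioi 0) := by
  refine Integrable.mono' (g := fun t => Real.exp ((m + 1) ^ 2 / (2 * x)) * Real.exp (-t))
    ((integrableOn_exp_neg_Ioi 0).const_mul _) ?_ ?_
  · exact Continuous.aestronglyMeasurable (by fun_prop)
  · refine (ae_restrict_iff' measurableSet_Ioi).mpr (Eventually.of_forall fun t ht => ?_)
    rw [norm_mul, Real.norm_eq_abs, Real.abs_exp, Real.norm_eq_abs]
    refine le_trans ?_ (exp_neg_mul_cosh_mul_exp_le hx m t)
    gcongr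
    exact hgm t ht

theorem besselK_integrableOn (n : ℕ) {x : ℝ} (hx : 0 < x) :
    IntegrableOn (fun t => Real.exp (-x * Real.cosh t) * Real.cosh (n * t)) (Set.Ioi 0) := by
  refine integrableOn_exp_neg_mul_cosh_mul hx n (by fun_prop) fun t ht => ?_
  rw [abs_of_pos (Real.cosh_pos _)]
  exact cosh_le_exp (by positivity)

theorem abs_sinh_mul_sinh_le (n : ℕ) {t : ℝ} (ht : 0 < t) :
    |Real.sinh t * Real.sinh (n * t)| ≤ Real.exp ((n + 1) * t) := by
  rw [abs_mul, add_mul, one_mul, add_comm, Real.exp_add]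
  gcongr
  · exact abs_sinh_le_exp ht.le
  · exact abs_sinh_le_exp (by positivity)

theorem integrableOn_sinh_mul_sinh (n : ℕ) {x : ℝ} (hx : 0 < x) :
    IntegrableOn (fun t => Real.exp (-x * Real.cosh t) * (Real.sinh t * Real.sinh (n * t)))
      (Set.Ioi 0) :=
  integrableOn_exp_neg_mul_cosh_mul hx (n + 1) (by fun_prop)
    fun t ht => abs_sinh_mul_sinh_le n ht

/-- Integration by parts against `exp (-x cosh t) sinh (n t)`, which vanishes at both ends. With the
addition formulas for `cosh ((n ± 1) t)`, it yields both derivative formulas for `K_n`. -/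
theorem integral_sinh_mul_sinh (n : ℕ) {x : ℝ} (hx : 0 < x) :
    ∫ t in Set.Ioi (0 : ℝ), Real.exp (-x * Real.cosh t) * (Real.sinh t * Real.sinh (n * t)) =
      n / x * besselK n x := by
  have hd : ∀ t ∈ Set.Ici (0 : ℝ), HasDerivAt
      (fun t => Real.exp (-x * Real.cosh t) * Real.sinh (n * t))
      (-x * (Real.exp (-x * Real.cosh t) * (Real.sinh t * Real.sinh (n * t))) +
        n * (Real.exp (-x * Real.cosh t) * Real.cosh (n * t))) t := fun t _ => by
    have h1 : HasDerivAt (fun t : ℝ => (n : ℝ) * t) n t := by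
      simpa using (hasDerivAt_id t).const_mul (n : ℝ)
    refine ((((Real.hasDerivAt_cosh t).const_mul (-x)).exp).mul h1.sinh).congr_deriv ?_
    ring
  have hi1 := (integrableOn_sinh_mul_sinh n hx).const_mul (-x)
  have hi2 := (besselK_integrableOn n hx).const_mul (n : ℝ)
  have hlim : Tendsto (fun t => Real.exp (-x * Real.cosh t) * Real.sinh (n * t)) atTop (𝓝 0) := by
    refine squeeze_zero_norm' (a := fun t => Real.exp ((n + 1 : ℝ) ^ 2 / (2 * x)) * Real.exp (-t))
      ?_ ?_
    · filter_upwards [eventually_ge_atTop 0] with t ht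
      rw [norm_mul, Real.norm_eq_abs, Real.abs_exp, Real.norm_eq_abs]
      refine le_trans ?_ (exp_neg_mul_cosh_mul_exp_le hx n t)
      gcongr
      exact abs_sinh_le_exp (by positivity)
    · simpa using (Real.tendsto_exp_neg_atTop_nhds_zero).const_mul _
  have key := integral_Ioi_of_hasDerivAt_of_tendsto' hd (hi1.add hi2) hlim
  rw [integral_add hi1 hi2, integral_const_mul, integral_const_mul] at key
  simp only [mul_zero, Real.sinh_zero, sub_zero] at key
  rw [besselK, div_mul_eq_mul_div, eq_div_iff hx.ne']
  linarith

theorem besselK_hasDerivAt_aux (n : ℕ) {x : ℝ} (hx : 0 < x) :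
    HasDerivAt (besselK n) (∫ t in Set.Ioi (0 : ℝ),
      -(Real.exp (-x * Real.cosh t) * (Real.cosh t * Real.cosh (n * t)))) x := by
  have hcc : ∀ t : ℝ, 0 < t → Real.cosh t * Real.cosh (n * t) ≤ Real.exp ((n + 1) * t) := by
    intro t ht
    rw [add_mul, one_mul, add_comm, Real.exp_add]
    exact mul_le_mul (cosh_le_exp ht.le) (cosh_le_exp (by positivity)) (Real.cosh_pos _).le
      (Real.exp_pos _).le
  refine (hasDerivAt_integral_of_dominated_loc_of_deriv_le
    (F := fun x t => Real.exp (-x * Real.cosh t) * Real.cosh (n * t))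
    (F' := fun x t => -(Real.exp (-x * Real.cosh t) * (Real.cosh t * Real.cosh (n * t))))
    -- The parameter stays in `(x / 2, ∞)`, so the integrand at `x / 2` dominates.
    (bound := fun t => Real.exp (-(x / 2) * Real.cosh t) * (Real.cosh t * Real.cosh (n * t)))
    (Ioi_mem_nhds (half_lt_self hx)) ?_ (besselK_integrableOn n hx) ?_ ?_ ?_ ?_).2
  · exact Eventually.of_forall fun y => Continuous.aestronglyMeasurable (by fun_prop)
  · exact Continuous.aestronglyMeasurable (by fun_prop)
  · refine (ae_restrict_iff' measurableSet_Ioi).mpr (Eventually.of_forall fun t ht y hy => ?_)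
    have h1 := Real.cosh_pos t
    have h2 := Real.cosh_pos (n * t)
    rw [norm_neg, Real.norm_of_nonneg (by positivity)]
    gcongr
    exact (Set.mem_Ioi.mp hy).le
  · refine integrableOn_exp_neg_mul_cosh_mul (half_pos hx) (n + 1) (by fun_prop) fun t ht => ?_
    rw [abs_of_pos (mul_pos (Real.cosh_pos _) (Real.cosh_pos _))]
    exact hcc t ht
  · refine Eventually.of_forall fun t y _ => ?_
    have h1 : HasDerivAt (fun y : ℝ => -y * Real.cosh t) (-Real.cosh t) y := by
      simpa using (hasDerivAt_id y).neg.mul_const (Real.cosh t)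
    refine (h1.exp.mul_const (Real.cosh (n * t))).congr_deriv ?_
    ring

theorem besselK_hasDerivAt (n : ℕ) {x : ℝ} (hx : 0 < x) :
    HasDerivAt (besselK n) (n / x * besselK n x - besselK (n + 1) x) x := by
  convert besselK_hasDerivAt_aux n hx using 1
  rw [← integral_sinh_mul_sinh n hx, besselK,
    ← integral_sub (integrableOn_sinh_mul_sinh n hx) (besselK_integrableOn (n + 1) hx)]
  refine integral_congr_ae (Eventually.of_forall fun t => ?_)
  simp only
  push_cast
  rw [add_mul, one_mul, Real.cosh_add]
  ring

theorem besselK_succ_hasDerivAt (n : ℕ) {x : ℝ} (hx : 0 < x) :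
    HasDerivAt (besselK (n + 1)) (-besselK n x - (n + 1) / x * besselK (n + 1) x) x := by
  convert besselK_hasDerivAt_aux (n + 1) hx using 1
  have h1 := integral_sinh_mul_sinh (n + 1) hx
  have h2 := integrableOn_sinh_mul_sinh (n + 1) hx
  rw [Nat.cast_succ] at h1 h2
  rw [← h1, besselK, ← integral_neg, ← integral_sub (besselK_integrableOn n hx).fun_neg h2]
  refine integral_congr_ae (Eventually.of_forall fun t => ?_)
  simp only
  push_cast
  rw [show (n : ℝ) * t = (n + 1) * t - t by ring, Real.cosh_sub]
  ring

theorem besselK_rec (n : ℕ) {x : ℝ} (hx : 0 < x) :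
    besselK (n + 2) x = besselK n x + 2 * (n + 1) / x * besselK (n + 1) x := by
  have := (besselK_hasDerivAt (n + 1) hx).unique (besselK_succ_hasDerivAt n hx)
  push_cast at this
  linear_combination -this

theorem besselK_pos (n : ℕ) {x : ℝ} (hx : 0 < x) : 0 < besselK n x := by
  refine (setIntegral_pos_iff_support_of_nonneg_ae (Eventually.of_forall fun t => ?_)
    (besselK_integrableOn n hx)).mpr ?_
  · exact (mul_pos (Real.exp_pos _) (Real.cosh_pos _)).le
  · have : Set.Ioi 0 ⊆ Function.support
        fun t : ℝ => Real.exp (-x * Real.cosh t) * Real.cosh (n * t) :=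
      fun t _ => (mul_pos (Real.exp_pos _) (Real.cosh_pos _)).ne'
    rw [Set.inter_eq_right.mpr this]
    simp

theorem besselK_le_succ (n : ℕ) {x : ℝ} (hx : 0 < x) : besselK n x ≤ besselK (n + 1) x := by
  refine setIntegral_mono_on (besselK_integrableOn n hx) (besselK_integrableOn (n + 1) hx)
    measurableSet_Ioi fun t ht => ?_
  have ht' : (0 : ℝ) < t := ht
  gcongr
  rw [Real.cosh_le_cosh, abs_of_nonneg (by positivity), abs_of_nonneg (by positivity)]
  gcongr
  omega

/-! ### The Wronskian -/

/-- `x (I_n K_{n+1} + I_{n+1} K_n)`, the Wronskian of `K_n` and `I_n` for `x d/dx`. -/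
def besselWronskian (n : ℕ) (x : ℝ) : ℝ :=
  x * (besselI n x * besselK (n + 1) x + besselI (n + 1) x * besselK n x)

theorem besselWronskian_hasDerivAt (n : ℕ) {x : ℝ} (hx : 0 < x) :
    HasDerivAt (besselWronskian n) 0 x := by
  refine ((hasDerivAt_id x).mul (((besselI_hasDerivAt n hx).mul (besselK_succ_hasDerivAt n hx)).add
    ((besselI_succ_hasDerivAt n hx).mul (besselK_hasDerivAt n hx)))).congr_deriv ?_
  simp only [Pi.add_apply, Pi.mul_apply, id]
  field_simp
  ring

theorem besselWronskian_eq_one (n : ℕ) {x : ℝ} (hx : 0 < x) :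
    besselWronskian n x = besselWronskian n 1 :=
  (convex_Ioi (0 : ℝ)).is_const_of_fderivWithin_eq_zero (𝕜 := ℝ)
    (fun y hy => (besselWronskian_hasDerivAt n hy).differentiableAt.differentiableWithinAt)
    (fun y hy => by
      rw [fderivWithin_of_isOpen isOpen_Ioi hy]
      ext
      simpa using (besselWronskian_hasDerivAt n hy).deriv) hx (by simp)

theorem besselWronskian_succ (n : ℕ) {x : ℝ} (hx : 0 < x) :
    besselWronskian (n + 1) x = besselWronskian n x := by
  rw [besselWronskian, besselWronskian, besselI_rec n hx, besselK_rec n hx]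
  ring

/-- Zero derivative removes the dependence on `x`, and the three-term recurrences remove that on
`n`. Only the positivity of the constant is needed, not its value. -/
theorem besselWronskian_eq (n : ℕ) {x : ℝ} (hx : 0 < x) :
    besselWronskian n x = besselWronskian 0 1 := by
  rw [besselWronskian_eq_one n hx]
  induction n with
  | zero => rfl
  | succ n ih => rw [besselWronskian_succ n one_pos, ih]

theorem besselWronskian_pos : 0 < besselWronskian 0 1 := by
  have h1 := besselI_pos 0 one_pos
  have h2 := besselI_pos 1 one_pos
  have h3 := besselK_pos 0 one_pos
  have h4 := besselK_pos 1 one_pos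
  rw [besselWronskian]
  positivity

/-! ### Logarithmic derivatives -/

/-- `x I_n'(x) / I_n(x)`. -/
def logDerivI (n : ℕ) (x : ℝ) : ℝ := n + x * besselI (n + 1) x / besselI n x

/-- `-x K_n'(x) / K_n(x)`. -/
def logDerivK (n : ℕ) (x : ℝ) : ℝ := -n + x * besselK (n + 1) x / besselK n x

theorem mul_deriv_besselI (n : ℕ) {x : ℝ} (hx : 0 < x) :
    x * deriv (besselI n) x = logDerivI n x * besselI n x := by
  have := besselI_pos n hx
  rw [(besselI_hasDerivAt n hx).deriv, logDerivI]
  field_simp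

theorem mul_deriv_besselK (n : ℕ) {x : ℝ} (hx : 0 < x) :
    x * deriv (besselK n) x = -logDerivK n x * besselK n x := by
  have := besselK_pos n hx
  rw [(besselK_hasDerivAt n hx).deriv, logDerivK]
  field_simp
  ring

theorem besselI_mul_besselK (n : ℕ) {x : ℝ} (hx : 0 < x) :
    besselI n x * besselK n x * (logDerivI n x + logDerivK n x) = besselWronskian 0 1 := by
  have h1 := besselI_pos n hx
  have h2 := besselK_pos n hx
  rw [← besselWronskian_eq n hx, besselWronskian, logDerivI, logDerivK]
  field_simp
  ring

theorem logDerivI_hasDerivAt (n : ℕ) {x : ℝ} (hx : 0 < x) :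
    HasDerivAt (logDerivI n) ((x ^ 2 + n ^ 2 - logDerivI n x ^ 2) / x) x := by
  have h1 := besselI_pos n hx
  refine ((((hasDerivAt_id x).mul (besselI_succ_hasDerivAt n hx)).div (besselI_hasDerivAt n hx)
    h1.ne').const_add (n : ℝ)).congr_deriv ?_
  simp only [Pi.mul_apply, id, logDerivI]
  field_simp
  ring

theorem logDerivK_hasDerivAt (n : ℕ) {x : ℝ} (hx : 0 < x) :
    HasDerivAt (logDerivK n) ((logDerivK n x ^ 2 - (x ^ 2 + n ^ 2)) / x) x := by
  have h1 := besselK_pos n hx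
  refine ((((hasDerivAt_id x).mul (besselK_succ_hasDerivAt n hx)).div (besselK_hasDerivAt n hx)
    h1.ne').const_add (-n : ℝ)).congr_deriv ?_
  simp only [Pi.mul_apply, id, logDerivK]
  field_simp
  ring

theorem le_logDerivI (n : ℕ) {x : ℝ} (hx : 0 < x) : n ≤ logDerivI n x := by
  have h1 := besselI_pos n hx
  have h2 := besselI_pos (n + 1) hx
  rw [logDerivI]
  have : 0 ≤ x * besselI (n + 1) x / besselI n x := by positivity
  linarith

theorem logDerivI_le (n : ℕ) {x : ℝ} (hx : 0 < x) : logDerivI n x ≤ n + x ^ 2 / 2 := by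
  rw [logDerivI]
  refine add_le_add le_rfl ?_
  rw [div_le_iff₀ (besselI_pos n hx)]
  calc x * besselI (n + 1) x ≤ x * (x / 2 * besselI n x) := by
        gcongr
        exact besselI_succ_le n hx
    _ = x ^ 2 / 2 * besselI n x := by ring

/-- The recurrence trades `K_{n+2} / K_{n+1}` for `K_n / K_{n+1}`, which lies in `[0, 1]`. This and
the next bound are the crude a priori input for the Riccati estimates. -/
theorem le_logDerivK (n : ℕ) {x : ℝ} (hx : 0 < x) : n + 1 ≤ logDerivK (n + 1) x := by
  have h1 := besselK_pos n hx
  have h2 := besselK_pos (n + 1) hx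
  rw [logDerivK, besselK_rec n hx]
  have h : x * (besselK n x + 2 * (n + 1) / x * besselK (n + 1) x) / besselK (n + 1) x =
      x * besselK n x / besselK (n + 1) x + 2 * (n + 1) := by
    field_simp
  have h3 : 0 ≤ x * besselK n x / besselK (n + 1) x := by positivity
  rw [h]
  push_cast
  linarith

theorem logDerivK_le (n : ℕ) {x : ℝ} (hx : 0 < x) : logDerivK (n + 1) x ≤ n + 1 + x := by
  have h1 := besselK_pos n hx
  have h2 := besselK_pos (n + 1) hx
  rw [logDerivK, besselK_rec n hx]
  have h : x * (besselK n x + 2 * (n + 1) / x * besselK (n + 1) x) / besselK (n + 1) x =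
      x * besselK n x / besselK (n + 1) x + 2 * (n + 1) := by
    field_simp
  have h3 : x * besselK n x / besselK (n + 1) x ≤ x := by
    rw [div_le_iff₀ h2]
    gcongr
    exact besselK_le_succ n hx
  rw [h]
  push_cast
  linarith

/-! ### Stability of the Riccati equations -/

/-- The damping `p ≥ n` balances the forcing `|R| ≤ 1 / 4` at `|d| = 1 / (4 n)`. With `c` the square
of this level, `(d² - c) y ^ n` is antitone and vanishes at `0⁺` because `d` is bounded there, so it
is nonpositive. -/
theorem sq_le_of_stable {d p R : ℝ → ℝ} {n : ℕ} {B : ℝ} (hn : 1 ≤ n)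
    (hd : ∀ x, 0 < x → HasDerivAt d (-(p x * d x + R x) / x) x)
    (hp : ∀ x, 0 < x → (n : ℝ) ≤ p x) (hR : ∀ x, 0 < x → |R x| ≤ 1 / 4)
    (hB : ∀ x, 0 < x → x < 1 → |d x| ≤ B) {x : ℝ} (hx : 0 < x) :
    d x ^ 2 ≤ 1 / (16 * n ^ 2) := by
  have hn' : (0 : ℝ) < n := by exact_mod_cast hn
  set c : ℝ := 1 / (16 * n ^ 2) with hc
  have hG : ∀ y, 0 < y → HasDerivAt (fun y => (d y ^ 2 - c) * y ^ n)
      (y ^ (n - 1) * (-2 * p y * d y ^ 2 - 2 * R y * d y + n * d y ^ 2 - n * c)) y := by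
    intro y hy
    refine ((((hd y hy).fun_pow 2).sub_const c).mul (hasDerivAt_pow n y)).congr_deriv ?_
    obtain ⟨m, rfl⟩ : ∃ m, n = m + 1 := ⟨n - 1, by omega⟩
    rw [Nat.add_sub_cancel]
    push_cast
    field_simp
    ring
  have hnc : n * c = 1 / (16 * n) := by rw [hc]; field_simp
  have hanti : AntitoneOn (fun y => (d y ^ 2 - c) * y ^ n) (Set.Ioi 0) := by
    refine antitoneOn_of_deriv_nonpos (convex_Ioi 0)
      (fun y hy => (hG y hy).continuousAt.continuousWithinAt)
      (fun y hy => (hG y (by simpa using hy)).differentiableAt.differentiableWithinAt)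
      fun y hy => ?_
    rw [interior_Ioi] at hy
    have hy' : (0 : ℝ) < y := hy
    rw [(hG y hy').deriv]
    refine mul_nonpos_of_nonneg_of_nonpos (by positivity) ?_
    have h1 : -(R y * d y) ≤ 1 / 4 * |d y| := by
      refine (neg_le_abs _).trans ?_
      rw [abs_mul]
      gcongr
      exact hR y hy'
    have h2 : 1 / 2 * |d y| ≤ n * d y ^ 2 + n * c := by
      -- The value of `c` is exactly what makes this a perfect square.
      have : n * d y ^ 2 + n * c - 1 / 2 * |d y| = n * (|d y| - 1 / (4 * n)) ^ 2 := by
        rw [hnc, ← sq_abs (d y)]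
        field_simp
        ring
      have h3 : 0 ≤ (n : ℝ) * (|d y| - 1 / (4 * n)) ^ 2 := by positivity
      linarith
    have h3 : n * d y ^ 2 ≤ p y * d y ^ 2 := by
      gcongr
      exact hp y hy'
    linarith
  have hlim : Tendsto (fun y => (d y ^ 2 - c) * y ^ n) (𝓝[>] 0) (𝓝 0) := by
    have h0 : Tendsto (fun y : ℝ => (B ^ 2 + c) * y ^ n) (𝓝[>] 0) (𝓝 0) := by
      have : Continuous fun y : ℝ => (B ^ 2 + c) * y ^ n := by fun_prop
      have h := (this.tendsto 0).mono_left (nhdsWithin_le_nhds (s := Set.Ioi 0))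
      simpa [show n ≠ 0 by omega] using h
    refine squeeze_zero_norm' ?_ h0
    filter_upwards [Ioo_mem_nhdsGT (zero_lt_one' ℝ)] with y hy
    have hy0 : (0 : ℝ) < y := hy.1
    rw [norm_mul, norm_pow, Real.norm_of_nonneg hy0.le, Real.norm_eq_abs]
    gcongr
    have h1 : d y ^ 2 ≤ B ^ 2 := by
      rw [← sq_abs (d y)]
      gcongr
      exact hB y hy.1 hy.2
    have h2 : 0 ≤ d y ^ 2 := sq_nonneg _
    have h3 : 0 ≤ c := by positivity
    rw [abs_le]
    constructor <;> linarith
  have hle : (d x ^ 2 - c) * x ^ n ≤ 0 := by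
    refine ge_of_tendsto hlim ?_
    filter_upwards [Ioo_mem_nhdsGT hx] with y hy
    exact hanti hy.1 hx hy.2.le
  have := nonpos_of_mul_nonpos_left hle (by positivity)
  linarith

/-- Errors grow with `y`, so the estimate is run backwards from infinity: a solution of at most
linear growth must already be small. -/
theorem sq_le_of_unstable {d p R : ℝ → ℝ} {n : ℕ} {B : ℝ} (hn : 1 ≤ n)
    (hd : ∀ x, 0 < x → HasDerivAt d ((p x * d x + R x) / x) x)
    (hp : ∀ x, 0 < x → 2 * (n : ℝ) ≤ p x) (hR : ∀ x, 0 < x → |R x| ≤ 1 / 4)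
    (hB : ∀ x, 1 ≤ x → |d x| ≤ B * x) {x : ℝ} (hx : 0 < x) :
    d x ^ 2 ≤ 1 / (16 * n ^ 2) := by
  have hn' : (0 : ℝ) < n := by exact_mod_cast hn
  set c : ℝ := 1 / (16 * n ^ 2) with hc
  -- The exponent `3 n` leaves `4 n - 3 n = n` of the growth `2 p ≥ 4 n` to absorb the forcing, and
  -- is at least `3`, so it beats `d² = O(y²)` even for `n = 1`.
  have hG : ∀ y, 0 < y → HasDerivAt (fun y => (d y ^ 2 - c) / y ^ (3 * n))
      ((2 * p y * d y ^ 2 + 2 * R y * d y - 3 * n * d y ^ 2 + 3 * (n * c)) / y ^ (3 * n + 1))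
      y := by
    intro y hy
    refine ((((hd y hy).fun_pow 2).sub_const c).div (hasDerivAt_pow (3 * n) y)
      (by positivity)).congr_deriv ?_
    obtain ⟨m, hm⟩ : ∃ m, 3 * n = m + 1 := ⟨3 * n - 1, by omega⟩
    have hm' : (3 : ℝ) * n = m + 1 := by exact_mod_cast hm
    rw [← mul_assoc 3, hm', hm, Nat.add_sub_cancel]
    push_cast
    field_simp
    ring
  have hnc : n * c = 1 / (16 * n) := by rw [hc]; field_simp
  have hmono : MonotoneOn (fun y => (d y ^ 2 - c) / y ^ (3 * n)) (Set.Ioi 0) := by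
    refine monotoneOn_of_deriv_nonneg (convex_Ioi 0)
      (fun y hy => (hG y hy).continuousAt.continuousWithinAt)
      (fun y hy => (hG y (by simpa using hy)).differentiableAt.differentiableWithinAt)
      fun y hy => ?_
    rw [interior_Ioi] at hy
    have hy' : (0 : ℝ) < y := hy
    rw [(hG y hy').deriv]
    refine div_nonneg ?_ (by positivity)
    have h1 : -(R y * d y) ≤ 1 / 4 * |d y| := by
      refine (neg_le_abs _).trans ?_
      rw [abs_mul]
      gcongr
      exact hR y hy'
    have h2 : 1 / 2 * |d y| ≤ n * d y ^ 2 + n * c := by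
      have : n * d y ^ 2 + n * c - 1 / 2 * |d y| = n * (|d y| - 1 / (4 * n)) ^ 2 := by
        rw [hnc, ← sq_abs (d y)]
        field_simp
        ring
      have h3 : 0 ≤ (n : ℝ) * (|d y| - 1 / (4 * n)) ^ 2 := by positivity
      linarith
    have h3 : 2 * n * d y ^ 2 ≤ p y * d y ^ 2 := by
      gcongr
      exact hp y hy'
    have h4 : 0 ≤ n * c := by positivity
    linarith
  have hlim : Tendsto (fun y => (d y ^ 2 - c) / y ^ (3 * n)) atTop (𝓝 0) := by
    have h0 : Tendsto (fun y : ℝ => (B ^ 2 + c) / y) atTop (𝓝 0) :=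
      tendsto_const_nhds.div_atTop tendsto_id
    refine squeeze_zero_norm' ?_ h0
    filter_upwards [eventually_ge_atTop 1] with y hy
    have hy0 : (0 : ℝ) < y := by linarith
    have h3 : 0 ≤ c := by positivity
    have h1 : d y ^ 2 ≤ B ^ 2 * y ^ 2 := by
      rw [← sq_abs (d y), ← mul_pow]
      gcongr
      exact hB y hy
    have h2 : 0 ≤ d y ^ 2 := sq_nonneg _
    have h4 : c ≤ c * y ^ 2 := le_mul_of_one_le_right h3 (one_le_pow₀ hy)
    have h5 : |d y ^ 2 - c| ≤ (B ^ 2 + c) * y ^ 2 := by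
      rw [abs_le]
      have : 0 ≤ B ^ 2 * y ^ 2 := by positivity
      constructor <;> nlinarith
    rw [norm_div, norm_pow, Real.norm_of_nonneg hy0.le, Real.norm_eq_abs]
    calc |d y ^ 2 - c| / y ^ (3 * n) ≤ (B ^ 2 + c) * y ^ 2 / y ^ 3 := by
          gcongr
          omega
      _ = (B ^ 2 + c) / y := by field_simp
  have hle : (d x ^ 2 - c) / x ^ (3 * n) ≤ 0 := by
    refine ge_of_tendsto hlim ?_
    filter_upwards [eventually_ge_atTop x] with y hy
    exact hmono hx (hx.trans_le hy) hy
  have hxp : 0 < x ^ (3 * n) := by positivity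
  rw [div_le_iff₀ hxp] at hle
  linarith

/-! ### Two-term approximation of the logarithmic derivatives -/

theorem sqrt_add_hasDerivAt {n : ℕ} (hn : 1 ≤ n) (x : ℝ) :
    HasDerivAt (fun x : ℝ => √(x ^ 2 + n ^ 2)) (x / √(x ^ 2 + n ^ 2)) x := by
  have hn' : (0 : ℝ) < n := by exact_mod_cast hn
  refine (((hasDerivAt_pow 2 x).add_const ((n : ℝ) ^ 2)).sqrt (by positivity)).congr_deriv ?_
  field_simp
  norm_num

theorem correction_hasDerivAt {n : ℕ} (hn : 1 ≤ n) (x : ℝ) :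
    HasDerivAt (fun x : ℝ => x ^ 2 / (2 * (x ^ 2 + n ^ 2)))
      (n ^ 2 * x / (x ^ 2 + n ^ 2) ^ 2) x := by
  have hn' : (0 : ℝ) < n := by exact_mod_cast hn
  refine ((hasDerivAt_pow 2 x).div (((hasDerivAt_pow 2 x).add_const ((n : ℝ) ^ 2)).const_mul 2)
    (by positivity)).congr_deriv ?_
  field_simp
  ring

theorem correction_nonneg (n : ℕ) (x : ℝ) : 0 ≤ x ^ 2 / (2 * (x ^ 2 + (n : ℝ) ^ 2)) := by
  positivity

theorem correction_le (n : ℕ) {x : ℝ} (hx : 0 < x) :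
    x ^ 2 / (2 * (x ^ 2 + (n : ℝ) ^ 2)) ≤ 1 / 2 := by
  rw [div_le_iff₀ (by positivity)]
  nlinarith [sq_nonneg (n : ℝ)]

/-- With `s² = x² + n²`, the correction `κ = x² / (2 s²)` solves `2 s κ = x s'`. What remains of
either Riccati equation is `κ² - x κ'`, a difference of two numbers in `[0, 1 / 4]`. -/
theorem abs_residual_le (n : ℕ) {x : ℝ} (hx : 0 < x) :
    |(x ^ 2 / (2 * (x ^ 2 + (n : ℝ) ^ 2))) ^ 2 - n ^ 2 * x ^ 2 / (x ^ 2 + n ^ 2) ^ 2| ≤ 1 / 4 := by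
  have h1 : 0 ≤ (n : ℝ) ^ 2 * x ^ 2 / (x ^ 2 + n ^ 2) ^ 2 := by positivity
  have h2 : (n : ℝ) ^ 2 * x ^ 2 / (x ^ 2 + n ^ 2) ^ 2 ≤ 1 / 4 := by
    rw [div_le_iff₀ (by positivity)]
    nlinarith [sq_nonneg (x ^ 2 - (n : ℝ) ^ 2)]
  have h3 := correction_nonneg n x
  have h4 := correction_le n hx
  rw [abs_le]
  constructor <;> nlinarith

theorem le_sqrt_add (n : ℕ) (x : ℝ) : (n : ℝ) ≤ √(x ^ 2 + n ^ 2) :=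
  Real.le_sqrt_of_sq_le (by nlinarith [sq_nonneg x])

theorem sqrt_add_le (n : ℕ) {x : ℝ} (hx : 0 < x) : √(x ^ 2 + (n : ℝ) ^ 2) ≤ n + x := by
  have h : (0 : ℝ) ≤ n := n.cast_nonneg
  refine Real.sqrt_le_iff.mpr ⟨by positivity, ?_⟩
  nlinarith [mul_nonneg h hx.le]

theorem sq_logDerivI_sub_le {n : ℕ} (hn : 1 ≤ n) {x : ℝ} (hx : 0 < x) :
    (logDerivI n x - (√(x ^ 2 + n ^ 2) - x ^ 2 / (2 * (x ^ 2 + n ^ 2)))) ^ 2 ≤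
      1 / (16 * n ^ 2) := by
  have hn' : (1 : ℝ) ≤ n := by exact_mod_cast hn
  refine sq_le_of_stable (B := n + 1)
    (d := fun x => logDerivI n x - (√(x ^ 2 + n ^ 2) - x ^ 2 / (2 * (x ^ 2 + n ^ 2))))
    (p := fun x => logDerivI n x + (√(x ^ 2 + n ^ 2) - x ^ 2 / (2 * (x ^ 2 + n ^ 2))))
    (R := fun x => (x ^ 2 / (2 * (x ^ 2 + (n : ℝ) ^ 2))) ^ 2 - n ^ 2 * x ^ 2 / (x ^ 2 + n ^ 2) ^ 2)
    hn (fun y hy => ?_) (fun y hy => ?_) (fun y hy => abs_residual_le n hy) (fun y hy hy1 => ?_) hx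
  · refine ((logDerivI_hasDerivAt n hy).sub
      ((sqrt_add_hasDerivAt hn y).sub (correction_hasDerivAt hn y))).congr_deriv ?_
    have hs : √(y ^ 2 + (n : ℝ) ^ 2) ^ 2 = y ^ 2 + n ^ 2 := Real.sq_sqrt (by positivity)
    have hs0 : 0 < √(y ^ 2 + (n : ℝ) ^ 2) := by positivity
    set s := √(y ^ 2 + (n : ℝ) ^ 2)
    rw [← hs]
    field_simp
    ring
  -- The damping is at least `n + n - 1 / 2`, hence at least `n`.
  · have := le_logDerivI n hy
    have := le_sqrt_add n y
    have := correction_le n hy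
    linarith
  · have := le_logDerivI n hy
    have := logDerivI_le n hy
    have := le_sqrt_add n y
    have := sqrt_add_le n hy
    have := correction_le n hy
    have := correction_nonneg n y
    have : y ^ 2 ≤ 1 := pow_le_one₀ hy.le hy1.le
    rw [abs_le]
    constructor <;> linarith

theorem sq_logDerivK_sub_le {n : ℕ} (hn : 1 ≤ n) {x : ℝ} (hx : 0 < x) :
    (logDerivK n x - (√(x ^ 2 + n ^ 2) + x ^ 2 / (2 * (x ^ 2 + n ^ 2)))) ^ 2 ≤
      1 / (16 * n ^ 2) := by
  have hn' : (1 : ℝ) ≤ n := by exact_mod_cast hn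
  have hle : ∀ y, 0 < y → (n : ℝ) ≤ logDerivK n y ∧ logDerivK n y ≤ n + y := fun y hy => by
    obtain ⟨m, rfl⟩ : ∃ m, n = m + 1 := ⟨n - 1, by omega⟩
    rw [Nat.cast_succ]
    exact ⟨le_logDerivK m hy, logDerivK_le m hy⟩
  refine sq_le_of_unstable (B := n + 1)
    (d := fun x => logDerivK n x - (√(x ^ 2 + n ^ 2) + x ^ 2 / (2 * (x ^ 2 + n ^ 2))))
    (p := fun x => logDerivK n x + (√(x ^ 2 + n ^ 2) + x ^ 2 / (2 * (x ^ 2 + n ^ 2))))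
    (R := fun x => (x ^ 2 / (2 * (x ^ 2 + (n : ℝ) ^ 2))) ^ 2 - n ^ 2 * x ^ 2 / (x ^ 2 + n ^ 2) ^ 2)
    hn (fun y hy => ?_) (fun y hy => ?_) (fun y hy => abs_residual_le n hy) (fun y hy1 => ?_) hx
  · refine ((logDerivK_hasDerivAt n hy).sub
      ((sqrt_add_hasDerivAt hn y).add (correction_hasDerivAt hn y))).congr_deriv ?_
    have hs : √(y ^ 2 + (n : ℝ) ^ 2) ^ 2 = y ^ 2 + n ^ 2 := Real.sq_sqrt (by positivity)
    have hs0 : 0 < √(y ^ 2 + (n : ℝ) ^ 2) := by positivity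
    set s := √(y ^ 2 + (n : ℝ) ^ 2)
    rw [← hs]
    field_simp
    ring
  · have := (hle y hy).1
    have := le_sqrt_add n y
    have := correction_nonneg n y
    linarith
  · have hy : 0 < y := by linarith
    have := hle y hy
    have := le_sqrt_add n y
    have := sqrt_add_le n hy
    have := correction_le n hy
    have := correction_nonneg n y
    have : (n : ℝ) ≤ n * y := le_mul_of_one_le_right (by positivity) hy1
    rw [abs_le]
    constructor <;> linarith

/-! ### Asymptotics of `Γ_n` -/

theorem Gam_eq {h a b : ℝ} (hh : 0 < h) {n : ℕ} (hn : 1 ≤ n) :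
    Gam h n a b = n * b / h * deriv (besselI n) (n * b / h) *
      -(n * a / h * deriv (besselK n) (n * a / h)) / n ^ 2 := by
  have hn' : (0 : ℝ) < n := by exact_mod_cast hn
  rw [Gam]
  field_simp

theorem Gam_self_eq {h a : ℝ} (hh : 0 < h) (ha : 0 < a) {n : ℕ} (hn : 1 ≤ n) :
    Gam h n a a = besselWronskian 0 1 / n ^ 2 *
      (logDerivI n (n * a / h) * logDerivK n (n * a / h) /
        (logDerivI n (n * a / h) + logDerivK n (n * a / h))) := by
  have hn' : (0 : ℝ) < n := by exact_mod_cast hn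
  have hx : 0 < n * a / h := by positivity
  rw [Gam_eq hh hn, mul_deriv_besselI n hx, mul_deriv_besselK n hx, ← besselI_mul_besselK n hx]
  have h1 : logDerivI n (n * a / h) + logDerivK n (n * a / h) ≠ 0 := fun h0 => by
    have := besselI_mul_besselK n hx
    rw [h0, mul_zero] at this
    exact besselWronskian_pos.ne this
  field_simp

/-- The terms linear in `q` cancel from `s²` and `2 s`. The numerator left over is `s (d + e) / 2`
plus a bounded quantity, over a denominator at least `n`. -/
theorem abs_harmonic_sub_le {n s q d e : ℝ} (hn : 1 ≤ n) (hns : n ≤ s) (hq : 0 ≤ q)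
    (hq' : q ≤ 1 / 2) (hd : |d| ≤ 1 / (4 * n)) (he : |e| ≤ 1 / (4 * n)) :
    |(s - q + d) * (s + q + e) / ((s - q + d) + (s + q + e)) - s / 2| ≤
      (1 + s / n) / n := by
  have h4 : 1 / (4 * n) ≤ 1 / 4 := by
    gcongr
    linarith
  have hd' := abs_le.mp hd
  have he' := abs_le.mp he
  have hD : n ≤ (s - q + d) + (s + q + e) := by linarith
  have hD0 : 0 < (s - q + d) + (s + q + e) := by linarith
  have hid : (s - q + d) * (s + q + e) / ((s - q + d) + (s + q + e)) - s / 2 =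
      (s / 2 * (d + e) + (-q ^ 2 + q * (d - e) + d * e)) / ((s - q + d) + (s + q + e)) := by
    rw [eq_div_iff hD0.ne', sub_mul, div_mul_cancel₀ _ hD0.ne']
    ring
  have h1 : |s / 2 * (d + e)| ≤ s / n := by
    rw [abs_mul, abs_of_nonneg (by linarith)]
    have : |d + e| ≤ 2 / n := by
      refine (abs_add_le d e).trans ((add_le_add hd he).trans ?_)
      rw [← add_div, div_le_div_iff₀ (by linarith) (by linarith)]
      linarith
    calc s / 2 * |d + e| ≤ s / 2 * (2 / n) := by
          gcongr
          linarith
      _ = s / n := by ring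
  have h2 : |-q ^ 2 + q * (d - e) + d * e| ≤ 1 := by
    have hde : |d * e| ≤ 1 / 4 * (1 / 4) := by
      rw [abs_mul]
      gcongr <;> linarith
    have hqde : |q * (d - e)| ≤ 1 / 2 * (1 / 2) := by
      rw [abs_mul, abs_of_nonneg hq]
      gcongr
      rw [abs_le]
      constructor <;> linarith
    have := abs_le.mp hde
    have := abs_le.mp hqde
    rw [abs_le]
    constructor <;> nlinarith
  rw [hid, abs_div, abs_of_pos hD0]
  have hsn : 0 ≤ s / n := div_nonneg (by linarith) (by linarith)
  gcongr
  exact (abs_add_le _ _).trans (by linarith)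

theorem Gam_self_asymptotic {h a : ℝ} (hh : 0 < h) (ha : 0 < a) :
    ∃ A C : ℝ, 0 < A ∧ 0 ≤ C ∧ ∀ n : ℕ, 1 ≤ n → |Gam h n a a - A / n| ≤ C / n ^ 3 := by
  set σ : ℝ := √((a / h) ^ 2 + 1) with hσ
  have hW := besselWronskian_pos
  set W := besselWronskian 0 1
  have hσ0 : 0 < σ := by positivity
  refine ⟨W * (σ / 2), W * (1 + σ), by positivity, by positivity, fun n hn => ?_⟩
  have hn' : (1 : ℝ) ≤ n := by exact_mod_cast hn
  have hn0 : (0 : ℝ) < n := by linarith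
  have hx : 0 < n * a / h := by positivity
  have hs : √((n * a / h) ^ 2 + (n : ℝ) ^ 2) = n * σ := by
    rw [show (n * a / h) ^ 2 + (n : ℝ) ^ 2 = n ^ 2 * ((a / h) ^ 2 + 1) by ring,
      Real.sqrt_mul (by positivity), Real.sqrt_sq hn0.le]
  have habs : ∀ {d : ℝ}, d ^ 2 ≤ 1 / (16 * (n : ℝ) ^ 2) → |d| ≤ 1 / (4 * n) := fun {d} hd => by
    refine abs_le_of_sq_le_sq (hd.trans (le_of_eq ?_)) (by positivity)
    ring
  have key := abs_harmonic_sub_le hn' (le_sqrt_add n (n * a / h)) (correction_nonneg n (n * a / h))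
    (correction_le n hx) (habs (sq_logDerivI_sub_le hn hx)) (habs (sq_logDerivK_sub_le hn hx))
  rw [add_sub_cancel, add_sub_cancel, hs] at key
  rw [Gam_self_eq hh ha hn]
  set g := logDerivI n (n * a / h) * logDerivK n (n * a / h) /
    (logDerivI n (n * a / h) + logDerivK n (n * a / h))
  rw [show W / (n : ℝ) ^ 2 * g - W * (σ / 2) / n = W / n ^ 2 * (g - n * σ / 2) by field_simp,
    abs_mul, abs_of_pos (by positivity)]
  calc W / (n : ℝ) ^ 2 * |g - n * σ / 2| ≤ W / n ^ 2 * ((1 + n * σ / n) / n) := by gcongr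
    _ = W * (1 + σ) / n ^ 3 := by field_simp

theorem mul_deriv_besselI_scale (n : ℕ) {c x : ℝ} (hc : 0 < c) (hc1 : c ≤ 1) (hx : 0 < x) :
    c * x * deriv (besselI n) (c * x) ≤ c ^ n * (x * deriv (besselI n) x) := by
  have hcx : 0 < c * x := by positivity
  have h1 := besselI_mul_le n hc.le hc1 hx
  have h2 := besselI_mul_le (n + 1) hc.le hc1 hx
  have h3 := besselI_pos (n + 1) hx
  rw [(besselI_hasDerivAt n hcx).deriv, (besselI_hasDerivAt n hx).deriv, mul_add, mul_add,
    ← mul_assoc, ← mul_assoc x, mul_div_cancel₀ _ hcx.ne', mul_div_cancel₀ _ hx.ne', mul_add]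
  refine add_le_add ?_ ?_
  · calc n * besselI n (c * x) ≤ n * (c ^ n * besselI n x) := by gcongr
      _ = c ^ n * (n * besselI n x) := by ring
  · calc c * x * besselI (n + 1) (c * x) ≤ c * x * (c ^ (n + 1) * besselI (n + 1) x) := by gcongr
      _ = c ^ n * (c ^ 2 * (x * besselI (n + 1) x)) := by ring
      _ ≤ c ^ n * (1 * (x * besselI (n + 1) x)) := by
        gcongr
        exact pow_le_one₀ hc.le hc1
      _ = c ^ n * (x * besselI (n + 1) x) := by ring

/-- Both sides share the factor `K_n'(n a / h)`. Passing from `n a / h` to `n b / h` in `x I_n'(x)`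
costs a factor `(b / a) ^ n`. -/
theorem abs_Gam_le {h a b : ℝ} (hh : 0 < h) (hb : 0 < b) (hab : b ≤ a) {n : ℕ} (hn : 1 ≤ n) :
    |Gam h n a b| ≤ (b / a) ^ n * Gam h n a a := by
  have hn' : (1 : ℝ) ≤ n := by exact_mod_cast hn
  have hn0 : (0 : ℝ) < n := by linarith
  have ha : 0 < a := hb.trans_le hab
  have hx : 0 < n * a / h := by positivity
  have hy : 0 < n * b / h := by positivity
  have h1 := mul_deriv_besselI_scale n (div_pos hb ha) ((div_le_one ha).mpr hab) hx
  have hK : 0 ≤ -(n * a / h * deriv (besselK n) (n * a / h)) := by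
    rw [mul_deriv_besselK n hx, neg_mul, neg_neg]
    obtain ⟨m, rfl⟩ : ∃ m, n = m + 1 := ⟨n - 1, by omega⟩
    have := le_logDerivK m hx
    exact mul_nonneg (by linarith [m.cast_nonneg (α := ℝ)]) (besselK_pos _ hx).le
  have hI : 0 ≤ n * b / h * deriv (besselI n) (n * b / h) := by
    rw [mul_deriv_besselI n hy]
    exact mul_nonneg (hn0.le.trans (le_logDerivI n hy)) (besselI_pos _ hy).le
  rw [show b / a * (n * a / h) = n * b / h by field_simp] at h1
  rw [Gam_eq hh hn, Gam_eq hh hn,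
    abs_of_nonneg (div_nonneg (mul_nonneg hI hK) (by positivity)), ← mul_div_assoc, ← mul_assoc]
  exact div_le_div_of_nonneg_right (mul_le_mul_of_nonneg_right h1 hK) (by positivity)

/-! ### Sequences with expansion `A / n + O(1 / n³)` -/

theorem eventually_succ_lt_of_asymptotic {w : ℕ → ℝ} {A C : ℝ} (hA : 0 < A)
    (hw : ∀ᶠ n : ℕ in atTop, |w n - A / n| ≤ C / n ^ 3) :
    ∀ᶠ n : ℕ in atTop, w (n + 1) < w n := by
  filter_upwards [hw, (tendsto_add_atTop_nat 1).eventually hw, eventually_ge_atTop 1,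
    -- The goal reduces to `2 C (n + 1) < A n²`; since `n + 1 ≤ 2 n`, `n > 4 C / A` is enough.
    (tendsto_natCast_atTop_atTop (R := ℝ)).eventually_gt_atTop (4 * C / A)] with n h1 h2 hn h3
  have hn' : (1 : ℝ) ≤ n := by exact_mod_cast hn
  have hn0 : (0 : ℝ) < n := by linarith
  rw [div_lt_iff₀ hA] at h3
  have hC : 0 ≤ C := by
    have := (abs_nonneg _).trans h1
    by_contra! hneg
    exact absurd this (not_le.mpr (div_neg_of_neg_of_pos hneg (by positivity)))
  push_cast at h2
  have h4 : C / ((n : ℝ) + 1) ^ 3 ≤ C / n ^ 3 := by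
    gcongr
    linarith
  have h5 : 2 * (C / (n : ℝ) ^ 3) < A / n - A / (n + 1) := by
    rw [show A / (n : ℝ) - A / (n + 1) = A / (n * (n + 1)) by field_simp; ring, ← mul_div_assoc,
      div_lt_div_iff₀ (by positivity) (by positivity)]
    have h6 : 2 * C * (n + 1) ≤ 4 * C * n := by nlinarith
    have h7 : 4 * C * n < n * A * n := by gcongr
    calc 2 * C * (n * (n + 1)) = 2 * C * (n + 1) * n := by ring
      _ < n * A * n * n := mul_lt_mul_of_pos_right (h6.trans_lt h7) hn0
      _ = A * n ^ 3 := by ring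
  have := abs_le.mp h1
  have := abs_le.mp h2
  linarith

theorem tendsto_zero_of_asymptotic {w : ℕ → ℝ} {A C : ℝ}
    (hw : ∀ᶠ n : ℕ in atTop, |w n - A / n| ≤ C / n ^ 3) : Tendsto w atTop (𝓝 0) := by
  have h1 : Tendsto (fun n : ℕ => A / (n : ℝ)) atTop (𝓝 0) :=
    tendsto_const_div_atTop_nhds_zero_nat A
  have h2 : Tendsto (fun n : ℕ => C / (n : ℝ) ^ 3) atTop (𝓝 0) :=
    tendsto_const_nhds.div_atTop
      ((tendsto_pow_atTop (by norm_num)).comp tendsto_natCast_atTop_atTop)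
  have h3 : Tendsto (fun n : ℕ => w n - A / n) atTop (𝓝 0) := squeeze_zero_norm' hw h2
  simpa using h3.add h1

theorem strictAntiOn_of_succ_lt {w : ℕ → ℝ} {M : ℝ} (hw : ∀ n : ℕ, M < n → w (n + 1) < w n) :
    StrictAntiOn w {n : ℕ | M < n} := by
  intro m hm n _ hmn
  induction n, (show m + 1 ≤ n from hmn) using Nat.le_induction with
  | base => exact hw m hm
  | succ n hn ih =>
    have hMn : M < n := lt_trans hm (by exact_mod_cast hn)
    exact (hw n hMn).trans (ih hMn hn)

/-! ### The eigenvalues -/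

theorem isUnit_linMatrix_iff {h : ℝ} {n : ℕ} {a₁ a₂ Ω : ℝ} (hd : 0 ≤ discr h n a₁ a₂) :
    ¬ IsUnit (linMatrix h n Ω a₁ a₂) ↔
      Ω = OmegaPlus h n a₁ a₂ ∨ Ω = OmegaMinus h n a₁ a₂ := by
  have hdet : (linMatrix h n Ω a₁ a₂).det =
      (Ω - OmegaPlus h n a₁ a₂) * (Ω - OmegaMinus h n a₁ a₂) := by
    have hs := Real.sq_sqrt hd
    rw [linMatrix, Matrix.det_fin_two_of, OmegaPlus, OmegaMinus]
    have hdef := discr.eq_def h n a₁ a₂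
    linear_combination (1 / 4 : ℝ) * hs + (1 / 4 : ℝ) * hdef
  rw [Matrix.isUnit_iff_isUnit_det, isUnit_iff_ne_zero, not_not, hdet, mul_eq_zero, sub_eq_zero,
    sub_eq_zero]

theorem Upsilon_pos {h a b : ℝ} (hh : 0 < h) (hb : 0 < b) (hab : b < a) :
    0 < Upsilon h a b := by
  have ha : 0 < a := hb.trans hab
  have : 0 < a ^ 2 - b ^ 2 := by nlinarith
  rw [Upsilon]
  positivity

/-- The defect `T - √(T² - 4 Γ_n(a₁, a₂)²)`, where `T = Υ(a₁, a₂) - Γ_n(a₁, a₁) - Γ_n(a₂, a₂)`. -/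
def gapDefect (h : ℝ) (n : ℕ) (a₁ a₂ : ℝ) : ℝ :=
  Upsilon h a₁ a₂ - Gam h n a₁ a₁ - Gam h n a₂ a₂ - √(discr h n a₁ a₂)

theorem OmegaPlus_eq (h : ℝ) (n : ℕ) (a₁ a₂ : ℝ) :
    OmegaPlus h n a₁ a₂ = Upsilon h a₁ a₂ - (Gam h n a₁ a₁ + gapDefect h n a₁ a₂ / 2) := by
  rw [OmegaPlus, gapDefect]
  ring

theorem OmegaMinus_eq (h : ℝ) (n : ℕ) (a₁ a₂ : ℝ) :
    OmegaMinus h n a₁ a₂ = Gam h n a₂ a₂ + gapDefect h n a₁ a₂ / 2 := by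
  rw [OmegaMinus, gapDefect]
  ring

/-- With `s` the square root, `(T - s)(T + s) = 4 e²` and `T + s ≥ T`. -/
theorem sub_sqrt_bounds {T e : ℝ} (hT : 0 < T) (he : 0 ≤ T ^ 2 - 4 * e ^ 2) :
    0 ≤ T - √(T ^ 2 - 4 * e ^ 2) ∧ T - √(T ^ 2 - 4 * e ^ 2) ≤ 4 * e ^ 2 / T := by
  have hs := Real.sq_sqrt he
  have hs0 := Real.sqrt_nonneg (T ^ 2 - 4 * e ^ 2)
  set s := √(T ^ 2 - 4 * e ^ 2)
  have hsT : s ≤ T := abs_le_of_sq_le_sq' (by nlinarith [sq_nonneg e]) hT.le |>.2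
  refine ⟨by linarith, ?_⟩
  rw [le_div_iff₀ hT]
  nlinarith

theorem eventually_sq_Gam_le {h a b : ℝ} (hh : 0 < h) (hb : 0 < b) (hab : b < a) :
    ∃ D : ℝ, ∀ᶠ n : ℕ in atTop, Gam h n a b ^ 2 ≤ D / n ^ 3 := by
  have ha : 0 < a := hb.trans hab
  obtain ⟨A, C, hA, hC, hg⟩ := Gam_self_asymptotic hh ha
  have hr0 : 0 < b / a := by positivity
  have hr1 : b / a < 1 := (div_lt_one ha).mpr hab
  have hlim := tendsto_pow_const_mul_const_pow_of_abs_lt_one 3 (by rwa [abs_of_pos hr0])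
  refine ⟨(A + C) ^ 2, ?_⟩
  filter_upwards [eventually_ge_atTop 1, hlim.eventually_le_const one_pos] with n hn h1
  have hn' : (1 : ℝ) ≤ n := by exact_mod_cast hn
  have hn0 : (0 : ℝ) < n := by linarith
  have h2 : |Gam h n a b| ≤ (b / a) ^ n * (A + C) := by
    refine (abs_Gam_le hh hb hab.le hn).trans ?_
    gcongr
    have h3 := (abs_le.mp (hg n hn)).2
    have h4 : A / n ≤ A := div_le_self hA.le hn'
    have h5 : C / (n : ℝ) ^ 3 ≤ C := div_le_self hC (one_le_pow₀ hn')
    linarith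
  rw [le_div_iff₀ (by positivity), ← sq_abs]
  calc |Gam h n a b| ^ 2 * n ^ 3 ≤ ((b / a) ^ n * (A + C)) ^ 2 * n ^ 3 := by gcongr
    -- One factor `(b / a) ^ n` absorbs `n ^ 3`; the other is bounded by `1`.
    _ = (A + C) ^ 2 * ((b / a) ^ n * (n ^ 3 * (b / a) ^ n)) := by ring
    _ ≤ (A + C) ^ 2 * (1 * 1) := by
      gcongr
      exact pow_le_one₀ hr0.le hr1.le
    _ = (A + C) ^ 2 := by ring

theorem eventually_discr_pos_and_gapDefect_le {h a₁ a₂ : ℝ} (hh : 0 < h) (ha₂ : 0 < a₂)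
    (ha : a₂ < a₁) : ∃ D : ℝ, ∀ᶠ n : ℕ in atTop,
      0 < discr h n a₁ a₂ ∧ |gapDefect h n a₁ a₂ / 2| ≤ D / n ^ 3 := by
  have hU := Upsilon_pos hh ha₂ ha
  obtain ⟨A₁, C₁, -, -, hg₁⟩ := Gam_self_asymptotic hh (ha₂.trans ha)
  obtain ⟨A₂, C₂, -, -, hg₂⟩ := Gam_self_asymptotic hh ha₂
  obtain ⟨D, hD⟩ := eventually_sq_Gam_le hh ha₂ ha
  have t₁ : Tendsto (fun n => Gam h n a₁ a₁) atTop (𝓝 0) :=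
    tendsto_zero_of_asymptotic ((eventually_ge_atTop 1).mono hg₁)
  have t₂ : Tendsto (fun n => Gam h n a₂ a₂) atTop (𝓝 0) :=
    tendsto_zero_of_asymptotic ((eventually_ge_atTop 1).mono hg₂)
  have t₃ : Tendsto (fun n : ℕ => D / (n : ℝ) ^ 3) atTop (𝓝 0) :=
    tendsto_const_nhds.div_atTop
      ((tendsto_pow_atTop (by norm_num)).comp tendsto_natCast_atTop_atTop)
  set U := Upsilon h a₁ a₂ with hUdef
  refine ⟨4 * D / U, ?_⟩
  -- The two bounds `U / 4` give `T > U / 2`, and `Γ_n(a₁, a₂)² < U² / 16` then makes `T² - 4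
  -- Γ_n(a₁, a₂)²` positive.
  filter_upwards [hD, t₁.eventually_lt_const (show 0 < U / 4 by positivity),
    t₂.eventually_lt_const (show 0 < U / 4 by positivity),
    t₃.eventually_lt_const (show 0 < U ^ 2 / 16 by positivity)] with n h1 h2 h3 h4
  have hT : U / 2 < U - Gam h n a₁ a₁ - Gam h n a₂ a₂ := by linarith
  have hpos : 0 < discr h n a₁ a₂ := by
    rw [discr, ← hUdef]
    nlinarith
  refine ⟨hpos, ?_⟩
  obtain ⟨h5, h6⟩ := sub_sqrt_bounds (by linarith) hpos.le
  rw [gapDefect, discr, abs_of_nonneg (div_nonneg h5 zero_le_two)]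
  calc _ ≤ 4 * Gam h n a₁ a₂ ^ 2 / (U - Gam h n a₁ a₁ - Gam h n a₂ a₂) / 2 := by
        gcongr
    _ ≤ 4 * (D / n ^ 3) / (U / 2) / 2 := by
        have : 0 ≤ D / (n : ℝ) ^ 3 := (sq_nonneg _).trans h1
        gcongr
    _ = 4 * D / U / n ^ 3 := by
        field_simp

end HelicalWave

end

theorem proposition4p3 (h a₁ a₂ : ℝ) (hh : 0 < h) (ha₂ : 0 < a₂) (ha : a₂ < a₁) :
    ∃ M : ℝ, 0 < M ∧
      (∀ n : ℕ, M < n →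
        0 < HelicalWave.discr h n a₁ a₂ ∧
        HelicalWave.OmegaPlus h n a₁ a₂ ≠ HelicalWave.OmegaMinus h n a₁ a₂ ∧
        ∀ Ω : ℝ, ¬ IsUnit (HelicalWave.linMatrix h n Ω a₁ a₂) ↔
          Ω = HelicalWave.OmegaPlus h n a₁ a₂ ∨ Ω = HelicalWave.OmegaMinus h n a₁ a₂) ∧
      StrictMonoOn (fun n : ℕ => HelicalWave.OmegaPlus h n a₁ a₂) {n : ℕ | M < n} ∧
      StrictAntiOn (fun n : ℕ => HelicalWave.OmegaMinus h n a₁ a₂) {n : ℕ | M < n} ∧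
      Tendsto (fun n : ℕ => HelicalWave.OmegaPlus h n a₁ a₂) atTop
        (𝓝 (HelicalWave.Upsilon h a₁ a₂)) ∧
      0 < HelicalWave.Upsilon h a₁ a₂ ∧
      Tendsto (fun n : ℕ => HelicalWave.OmegaMinus h n a₁ a₂) atTop (𝓝 0) := by
  obtain ⟨D, hD⟩ := HelicalWave.eventually_discr_pos_and_gapDefect_le hh ha₂ ha
  have asymp : ∀ a : ℝ, 0 < a → ∃ A C : ℝ, 0 < A ∧ ∀ᶠ n : ℕ in atTop,
      |HelicalWave.Gam h n a a + HelicalWave.gapDefect h n a₁ a₂ / 2 - A / n| ≤ C / n ^ 3 := by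
    intro a ha'
    obtain ⟨A, C, hA, -, hg⟩ := HelicalWave.Gam_self_asymptotic hh ha'
    refine ⟨A, C + D, hA, ?_⟩
    filter_upwards [hD, eventually_ge_atTop 1] with n h1 h2
    rw [add_sub_right_comm, add_div]
    exact (abs_add_le _ _).trans (add_le_add (hg n h2) h1.2)
  obtain ⟨A₁, C₁, hA₁, hw₁⟩ := asymp a₁ (ha₂.trans ha)
  obtain ⟨A₂, C₂, hA₂, hw₂⟩ := asymp a₂ ha₂
  obtain ⟨N, hN⟩ := eventually_atTop.mp (hD.and
    ((HelicalWave.eventually_succ_lt_of_asymptotic hA₁ hw₁).and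
      (HelicalWave.eventually_succ_lt_of_asymptotic hA₂ hw₂)))
  have hN' : ∀ n : ℕ, (N : ℝ) + 1 < n → N ≤ n := fun n hn => by
    have : N + 1 < n := by exact_mod_cast hn
    omega
  -- The shift by `1` keeps the threshold positive when `N = 0`.
  refine ⟨N + 1, by positivity, fun n hn => ?_, ?_, ?_, ?_, HelicalWave.Upsilon_pos hh ha₂ ha, ?_⟩
  · have hpos := (hN n (hN' n hn)).1.1
    refine ⟨hpos, ?_, fun Ω => HelicalWave.isUnit_linMatrix_iff hpos.le⟩
    have := Real.sqrt_pos.mpr hpos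
    rw [HelicalWave.OmegaPlus, HelicalWave.OmegaMinus]
    intro heq
    linarith
  · have := HelicalWave.strictAntiOn_of_succ_lt
      (w := fun n => HelicalWave.Gam h n a₁ a₁ + HelicalWave.gapDefect h n a₁ a₂ / 2)
      fun n hn => (hN n (hN' n hn)).2.1
    simp only [HelicalWave.OmegaPlus_eq]
    exact fun m hm n hn hmn => sub_lt_sub_left (this hm hn hmn) _
  · simp only [HelicalWave.OmegaMinus_eq]
    exact HelicalWave.strictAntiOn_of_succ_lt fun n hn => (hN n (hN' n hn)).2.2
  · simp only [HelicalWave.OmegaPlus_eq]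
    simpa using (HelicalWave.tendsto_zero_of_asymptotic hw₁).const_sub
      (HelicalWave.Upsilon h a₁ a₂)
  · simp only [HelicalWave.OmegaMinus_eq]
    exact HelicalWave.tendsto_zero_of_asymptotic hw₂
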